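/- Write $e(x)=e^{2\pi i x}$ and let $\mathbb H$ be the complex upper half-plane. For integers $k$ and $m,N\ge 1$, let $J_{k,m}(N)$ be the space of Jacobi forms of weight $k$, index $m$ and level $N$, that is, of holomorphic functions $\phi:\mathbb H\times\mathbb C\to\mathbb C$ such that (1) $\phi|_{k,m}\gamma=\phi$ for all $\gamma\in\Gamma_0(N)$, where for $\gamma=\begin{pmatrix}a&b\\c&d\end{pmatrix}\in \mathrm{SL}(2,\mathbb Z)$ $$(\phi|_{k,m}\gamma)(\tau,z)=\phi\Big(\frac{a\tau+b}{c\tau+d},\frac{z}{c\tau+d}\Big)(c\tau+d)^{-k}\,e\Big(\frac{-mcz^2}{c\tau+d}\Big);$$ (2) $\phi(\tau,z+\lambda\tau+u)\,e\big(m(\lambda^2\tau+2\lambda z)\big)=\phi(\tau,z)$ for all $\lambda,u\in\mathbb Z$; (3) for every $\gamma\in \mathrm{SL}(2,\mathbb Z)$, the function $\phi|_{k,m}\gamma$ has an absolutely convergent Fourier expansion $\sum_{n\in\frac1N\mathbb Z,\ r\in\mathbb Z}c_\gamma(n,r)e(n\tau)e(rz)$ in which $c_\gamma(n,r)=0$ unless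 $4nm-r^2\ge 0$. For $\mu\in\mathbb Z$ let $$\Theta_{\mu,m}(\tau,z)=\sum_{n\in\mathbb Z}e\Big(\frac{(2mn-\mu)^2}{4m}\tau+(2mn-\mu)z\Big).$$ Let $N\ge 1$ be odd, let $m\ge 1$ be square-free with $(N,m)=1$, let $k\in\mathbb Z$, and let $\phi\in J_{k,m}(N)$ be non-zero. Then $\phi$ has a unique theta expansion $$\phi(\tau,z)=\sum_{\mu \bmod 2m}h_\mu(\tau)\,\Theta_{\mu,m}(\tau,z)$$ with functions $h_\mu:\mathbb H\to\mathbb C$ (the theta components of $\phi$), and there is a $\mu \bmod 2m$ with $(\mu,2m)=1$ such that $h_\mu\ne 0$. -/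

import Mathlib

noncomputable section

namespace Jacobi

open scoped MatrixGroups

/-- `e(z) = exp(2πiz)`. -/
def e (z : ℂ) : ℂ := Complex.exp (2 * Real.pi * Complex.I * z)

/-- The weight `k`, index `m` action of `γ = (a b; c d) ∈ SL(2, ℤ)`:
`(φ|γ)(τ, z) = φ((aτ + b)/(cτ + d), z/(cτ + d)) (cτ + d)^(-k) e(m · (-c z²)/(cτ + d))`. -/
def slash (k : ℤ) (m : ℕ) (γ : SL(2, ℤ)) (φ : UpperHalfPlane → ℂ → ℂ) :
    UpperHalfPlane → ℂ → ℂ := fun τ z =>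
  φ (γ • τ) (z / ((γ 1 0 : ℂ) * τ + (γ 1 1 : ℂ))) * ((γ 1 0 : ℂ) * τ + (γ 1 1 : ℂ)) ^ (-k) *
    e (m * (-(γ 1 0 : ℂ) * z ^ 2 / ((γ 1 0 : ℂ) * τ + (γ 1 1 : ℂ))))

/-- `ψ` has an absolutely convergent Fourier expansion
`ψ(τ, z) = ∑ c(n, r) e((n/N) τ) e(r z)` over `n, r ∈ ℤ`, in which `c(n, r) ≠ 0` only
if `4 (n/N) m - r² ≥ 0`. -/
def HasBoundedFourierExpansion (m N : ℕ) (ψ : UpperHalfPlane → ℂ → ℂ) : Prop :=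
  ∃ c : ℤ × ℤ → ℂ, (∀ p, c p ≠ 0 → (N : ℤ) * p.2 ^ 2 ≤ 4 * p.1 * m) ∧
    ∀ (τ : UpperHalfPlane) (z : ℂ),
      HasSum (fun p : ℤ × ℤ => c p * e ((p.1 : ℂ) / (N : ℂ) * τ) * e ((p.2 : ℂ) * z)) (ψ τ z)

/-- `φ` is a Jacobi form of weight `k`, index `m` and level `N` (for `m, N ≥ 1`).
The last condition is the boundedness condition at the cusps: every cusp is `γ ∞` for some
`γ ∈ SL(2, ℤ)`, and the width of each cusp of `Γ₀(N)` divides `N`. -/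
structure IsJacobiForm (k : ℤ) (m N : ℕ) (φ : UpperHalfPlane → ℂ → ℂ) : Prop where
  holomorphic : DifferentiableOn ℂ (fun p : ℂ × ℂ => φ (UpperHalfPlane.ofComplex p.1) p.2)
    {p : ℂ × ℂ | 0 < p.1.im}
  slash_eq : ∀ γ ∈ CongruenceSubgroup.Gamma0 N, slash k m γ φ = φ
  translate_eq : ∀ (l u : ℤ) (τ : UpperHalfPlane) (z : ℂ),
    φ τ (z + l * τ + u) * e (m * ((l : ℂ) ^ 2 * τ + 2 * l * z)) = φ τ z
  bounded_at_cusps : ∀ γ : SL(2, ℤ), HasBoundedFourierExpansion m N (slash k m γ φ)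

/-- The complex vector space `J_{k,m}(N)`. -/
def J (k : ℤ) (m N : ℕ) : Submodule ℂ (UpperHalfPlane → ℂ → ℂ) where
  carrier := {φ | IsJacobiForm k m N φ}
  zero_mem' :=
    { holomorphic := differentiableOn_const 0
      slash_eq := fun γ _ => by funext τ z; simp [slash]
      translate_eq := fun l u τ z => by simp
      bounded_at_cusps := fun γ => ⟨0, by simp, fun τ z => by
        simp [slash]⟩ }
  add_mem' {φ ψ} hφ hψ :=
    { holomorphic := hφ.holomorphic.add hψ.holomorphic
      slash_eq := fun γ hγ => by
        have h1 := hφ.slash_eq γ hγ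
        have h2 := hψ.slash_eq γ hγ
        funext τ z
        have h1 := congrFun (congrFun h1 τ) z
        have h2 := congrFun (congrFun h2 τ) z
        simp only [slash, Pi.add_apply, add_mul] at h1 h2 ⊢
        rw [h1, h2]
      translate_eq := fun l u τ z => by
        have h1 := hφ.translate_eq l u τ z
        have h2 := hψ.translate_eq l u τ z
        simp only [Pi.add_apply, add_mul]
        rw [h1, h2]
      bounded_at_cusps := fun γ => by
        obtain ⟨c, hc, hs⟩ := hφ.bounded_at_cusps γ
        obtain ⟨d, hd, ht⟩ := hψ.bounded_at_cusps γ
        refine ⟨c + d, fun p hp => ?_, fun τ z => ?_⟩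
        · by_cases h : c p = 0
          · exact hd p fun h' => hp (by simp [h, h'])
          · exact hc p h
        · have := (hs τ z).add (ht τ z)
          simpa only [slash, Pi.add_apply, add_mul] using this }
  smul_mem' a φ hφ :=
    { holomorphic := hφ.holomorphic.const_smul a
      slash_eq := fun γ hγ => by
        funext τ z
        have h1 := congrFun (congrFun (hφ.slash_eq γ hγ) τ) z
        simp only [slash, Pi.smul_apply, smul_eq_mul, mul_assoc] at h1 ⊢
        rw [h1]
      translate_eq := fun l u τ z => by
        have h1 := hφ.translate_eq l u τ z
        simp only [Pi.smul_apply, smul_eq_mul, mul_assoc] at h1 ⊢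
        rw [h1]
      bounded_at_cusps := fun γ => by
        obtain ⟨c, hc, hs⟩ := hφ.bounded_at_cusps γ
        refine ⟨a • c, fun p hp => hc p fun h => hp (by simp [h]), fun τ z => ?_⟩
        have := (hs τ z).mul_left a
        simpa only [slash, Pi.smul_apply, smul_eq_mul, mul_assoc] using this }

/-- The theta series
`Θ_{μ,m}(τ, z) = ∑_{n ∈ ℤ} e((2mn - μ)²/(4m) · τ + (2mn - μ) z)`. -/
def theta (m : ℕ) (μ : ℤ) (τ : UpperHalfPlane) (z : ℂ) : ℂ :=
  ∑' n : ℤ, e ((2 * m * n - μ : ℂ) ^ 2 / (4 * m) * τ + (2 * m * n - μ) * z)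

/-- The family `h = (h_μ)`, with `μ` running over the residues `0, …, 2m - 1` modulo `2m`,
is the family of theta components of `φ`: `φ(τ, z) = ∑_{μ mod 2m} h_μ(τ) Θ_{μ,m}(τ, z)`. -/
def IsThetaExpansion (m : ℕ) (φ : UpperHalfPlane → ℂ → ℂ)
    (h : Fin (2 * m) → UpperHalfPlane → ℂ) : Prop :=
  ∀ (τ : UpperHalfPlane) (z : ℂ),
    φ τ z = ∑ μ : Fin (2 * m), h μ τ * theta m ((μ : ℕ) : ℤ) τ z

end Jacobi

end

/-!
Collect the theta components of `φ` at `τ` into a vector `h τ : ZMod (2 * m) → ℂ`. For fixed `τ`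
the Fourier coefficients `a r` of `φ(τ, ·)` are unique, and the translation law makes
`a r * e(-r²τ/4m)` depend only on `r` modulo `2m`; this gives the theta expansion and its uniqueness
(`exists_eq_thetaSeries`, `thetaSeries_injective`).

Suppose that `h μ = 0` for all `μ` prime to `2m`. The Fourier expansions at the cusps `∞` and `0`
make `φ` and `φ|S` invariant under `τ ↦ τ + N`. The first invariance multiplies `h` by a diagonal
matrix with entries `e(-x²N/4m)` (`thetaSeries_add_nat`). By Poisson summation the components of
`φ|S` are the discrete Fourier transforms of those of `φ` (`thetaSeries_neg_inv`), so the second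
invariance gives the conjugate of this matrix by the Fourier transform. In other words, the values
of `h` are stable, up to scalars, under the Weil representation restricted to the subgroup generated
by the unipotent elements `(1 N; 0 1)` and `(1 0; N 1)`. As `N` is prime to `2m`, this suffices for
the following argument (`eq_zero_of_coprime_eq_zero`).

If `d` is the `p`-part of `2m`, an average of powers of the diagonal matrix is the projection onto
the vectors supported on the multiples of `d`, and its Fourier conjugate is, up to a scalar, the sum
over the cosets of the multiples of `2m/d` (`sum_coset_eq_zero`). So if the coordinate at one element
of a coset vanishes identically, then so does the sum over that coset. If `p ∣ x` and `p` divides `2m`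
only once, then `x` is the only element of its coset divisible by `p`, while the remaining elements
have fewer prime factors in common with `2m`; so by induction on the number of these prime factors
the vanishing of the coset sum gives `h x = 0`. The remaining case is `p = 2` with `m` even, where
the coset sum gives `h x + h (x + m) = 0`; the translation `τ ↦ τ + N` turns this into
`h x - h (x + m) = 0` (`e_quadratic_add_half`), and again `h x = 0`. Hence `h = 0` and `φ = 0`.
-/

noncomputable section

namespace Jacobi

open UpperHalfPlane

/-! ### The exponential function and Fourier series -/

theorem e_zero : e 0 = 1 := by simp [e]

theorem e_add (x y : ℂ) : e (x + y) = e x * e y := by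
  simp only [e, mul_add, Complex.exp_add]

theorem e_ne_zero (x : ℂ) : e x ≠ 0 := Complex.exp_ne_zero _

theorem e_intCast (j : ℤ) : e j = 1 :=
  Complex.exp_eq_one_iff.mpr ⟨j, by ring⟩

theorem e_nat_mul (c : ℕ) (x : ℂ) : e (c * x) = e x ^ c := by
  rw [e, e, ← Complex.exp_nat_mul]
  ring_nf

theorem stdAddChar_intCast {n : ℕ} [NeZero n] (j : ℤ) :
    ZMod.stdAddChar (j : ZMod n) = e (j / n) := by
  rw [ZMod.stdAddChar_coe, e]
  ring_nf

theorem integral_e_intCast_mul (j : ℤ) :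
    ∫ x in (0 : ℝ)..1, e (j * x) = if j = 0 then 1 else 0 := by
  split_ifs with h
  · simp [h, e_zero]
  · have hc : 2 * (Real.pi : ℂ) * Complex.I * j ≠ 0 := by
      simp [Real.pi_ne_zero, h]
    have h1 := e_intCast j
    rw [e] at h1
    simp only [e, ← mul_assoc]
    rw [integral_exp_mul_complex hc]
    simp [h1]

/-- The coefficients of an absolutely convergent Fourier series are determined by its values on
the real line. -/
theorem fourier_coeff_eq_zero {a : ℤ → ℂ} (h : ∀ x : ℝ, HasSum (fun r : ℤ => a r * e (r * x)) 0)
    (s : ℤ) : a s = 0 := by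
  have ha : Summable fun r : ℤ => ‖a r‖ := by
    simpa [e_zero] using (h 0).summable.norm
  have hnorm (y : ℝ) : ‖e (y : ℂ)‖ = 1 := by
    rw [e, show 2 * (Real.pi : ℂ) * Complex.I * y = ((2 * Real.pi * y : ℝ) : ℂ) * Complex.I by
      push_cast; ring, Complex.norm_exp_ofReal_mul_I]
  have he (j : ℤ) : Continuous fun x : ℝ => e (j * x) := by
    unfold e
    fun_prop
  have key := intervalIntegral.hasSum_integral_of_dominated_convergence
    (μ := MeasureTheory.volume) (a := 0) (b := 1)
    (F := fun (r : ℤ) (x : ℝ) => a r * e ((r - s : ℤ) * x)) (f := fun _ => 0)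
    (fun r _ => ‖a r‖)
    (fun r => (continuous_const.mul (he _)).aestronglyMeasurable)
    (fun r => Filter.Eventually.of_forall fun x _ => by
      have := hnorm (((r - s : ℤ) : ℝ) * x)
      push_cast at this ⊢
      rw [norm_mul, this, mul_one])
    (Filter.Eventually.of_forall fun _ _ => ha) intervalIntegrable_const
    (Filter.Eventually.of_forall fun x _ => by
      have := (h x).mul_right (e (-s * x))
      rw [zero_mul] at this
      refine this.congr_fun fun r => ?_
      rw [mul_assoc, ← e_add]
      push_cast
      ring_nf)
  have h2 : ∀ r : ℤ, ∫ x in (0 : ℝ)..1, a r * e ((r - s : ℤ) * x) = if r = s then a s else 0 := by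
    intro r
    rw [intervalIntegral.integral_const_mul, integral_e_intCast_mul]
    by_cases hr : r = s <;> simp [hr, sub_eq_zero]
  simp only [h2, intervalIntegral.integral_zero] at key
  exact (hasSum_ite_eq s (a s)).unique key

/-! ### Theta series and their transformation laws -/

section ThetaSeries

variable {m : ℕ}

/-- The theta series with coefficient vector `H`, that is `∑ H(μ) Θ_{μ,m}`, as a Fourier series
in `z`: the exponent `r` occurs in `Θ_{μ,m}` exactly for `r ≡ -μ` modulo `2m`. -/
def thetaSeries (m : ℕ) (H : ZMod (2 * m) → ℂ) (τ : ℍ) (z : ℂ) : ℂ :=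
  ∑' r : ℤ, H (-r) * e ((r : ℂ) ^ 2 / (4 * m) * τ + r * z)

theorem e_gauss_eq_jacobiTheta₂_term (r : ℤ) (τ z : ℂ) :
    e ((r : ℂ) ^ 2 / (4 * m) * τ + r * z) = jacobiTheta₂_term r z (τ / (2 * m)) := by
  rw [jacobiTheta₂_term, e]
  ring_nf

theorem div_two_mul_im_pos [NeZero m] (τ : ℍ) : 0 < ((τ : ℂ) / (2 * m)).im := by
  have hm : (0 : ℝ) < 2 * m := by
    have := Nat.pos_of_ne_zero (NeZero.ne m)
    positivity
  have : (τ : ℂ) / (2 * m) = (τ : ℂ) / ((2 * m : ℝ) : ℂ) := by push_cast; rfl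
  rw [this, Complex.div_ofReal_im]
  exact div_pos τ.im_pos hm

theorem hasSum_thetaSeries [NeZero m] (H : ZMod (2 * m) → ℂ) (τ : ℍ) (z : ℂ) :
    HasSum (fun r : ℤ => H (-r) * e ((r : ℂ) ^ 2 / (4 * m) * τ + r * z))
      (thetaSeries m H τ z) := by
  refine Summable.hasSum (Summable.of_norm_bounded
    (g := fun r : ℤ => (∑ x, ‖H x‖) * ‖jacobiTheta₂_term r z ((τ : ℂ) / (2 * m))‖)
    ((hasSum_jacobiTheta₂_term z (div_two_mul_im_pos τ)).summable.norm.mul_left _) fun r => ?_)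
  rw [e_gauss_eq_jacobiTheta₂_term, norm_mul]
  gcongr
  exact Finset.single_le_sum (f := fun x => ‖H x‖) (fun _ _ => norm_nonneg _) (Finset.mem_univ _)

theorem thetaSeries_injective [NeZero m] {H H' : ZMod (2 * m) → ℂ} {τ : ℍ}
    (h : ∀ z, thetaSeries m H τ z = thetaSeries m H' τ z) : H = H' := by
  have h0 (r : ℤ) : (H (-r) - H' (-r)) * e ((r : ℂ) ^ 2 / (4 * m) * τ) = 0 := by
    refine fourier_coeff_eq_zero
      (a := fun r => (H (-r) - H' (-r)) * e ((r : ℂ) ^ 2 / (4 * m) * τ)) (fun x => ?_) r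
    have := (hasSum_thetaSeries H τ x).sub (hasSum_thetaSeries H' τ x)
    rw [h, sub_self] at this
    refine this.congr_fun fun r => ?_
    rw [e_add]
    ring
  funext x
  obtain ⟨j, rfl⟩ := ZMod.intCast_surjective x
  have := h0 (-j)
  simpa [e_ne_zero, sub_eq_zero] using this

theorem theta_eq_thetaSeries [NeZero m] (x : ℤ) (τ : ℍ) (z : ℂ) :
    theta m x τ z = thetaSeries m (Pi.single (x : ZMod (2 * m)) 1) τ z := by
  have hm : m ≠ 0 := NeZero.ne m
  have hinj : Function.Injective fun n : ℤ => 2 * (m : ℤ) * n - x := fun a b hab => by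
    simpa [hm] using hab
  rw [thetaSeries, theta, ← hinj.tsum_eq (f := fun r : ℤ =>
    (Pi.single (x : ZMod (2 * m)) (1 : ℂ) : ZMod (2 * m) → ℂ) (-r) *
      e ((r : ℂ) ^ 2 / (4 * m) * τ + r * z))]
  · refine tsum_congr fun n => ?_
    have h2 : (2 : ZMod (2 * m)) * (m : ZMod (2 * m)) = 0 := by
      exact_mod_cast ZMod.natCast_self (2 * m)
    push_cast
    simp [h2]
  · intro r hr
    have hx : (-r : ZMod (2 * m)) = x := by
      by_contra hne
      exact hr (by simp [hne])
    have h0 : ((x + r : ℤ) : ZMod (2 * m)) = 0 := by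
      push_cast
      rw [← hx]
      ring
    obtain ⟨j, hj⟩ := (ZMod.intCast_zmod_eq_zero_iff_dvd _ _).mp h0
    refine ⟨j, ?_⟩
    push_cast at hj
    simp only
    linarith

theorem sum_mul_thetaSeries [NeZero m] {ι : Type*} (s : Finset ι) (a : ι → ℂ)
    (H : ι → ZMod (2 * m) → ℂ) (τ : ℍ) (z : ℂ) :
    ∑ i ∈ s, a i * thetaSeries m (H i) τ z = thetaSeries m (fun x => ∑ i ∈ s, a i * H i x) τ z := by
  have := hasSum_sum fun i (_ : i ∈ s) => (hasSum_thetaSeries (H i) τ z).mul_left (a i)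
  refine (HasSum.unique (this.congr_fun fun r => ?_) (hasSum_thetaSeries _ τ z))
  simp only [Finset.sum_mul, mul_assoc]

theorem mul_thetaSeries (a : ℂ) (H : ZMod (2 * m) → ℂ) (τ : ℍ) (z : ℂ) :
    a * thetaSeries m H τ z = thetaSeries m (fun x => a * H x) τ z := by
  rw [thetaSeries, ← tsum_mul_left]
  simp only [thetaSeries, mul_assoc]

theorem thetaSeries_eq_sum_theta [NeZero m] (H : ZMod (2 * m) → ℂ) (τ : ℍ) (z : ℂ) :
    thetaSeries m H τ z = ∑ x : ZMod (2 * m), H x * theta m (x.val : ℤ) τ z := by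
  simp only [theta_eq_thetaSeries]
  rw [sum_mul_thetaSeries]
  congr 1
  funext y
  simp [Pi.single_apply]

/-- A family indexed by `0, …, 2m - 1`, reindexed by the residues modulo `2m`. -/
def toResidues [NeZero m] (h : Fin (2 * m) → ℍ → ℂ) (τ : ℍ) (x : ZMod (2 * m)) : ℂ :=
  h ⟨x.val, ZMod.val_lt x⟩ τ

theorem toResidues_natCast [NeZero m] (h : Fin (2 * m) → ℍ → ℂ) (τ : ℍ) (μ : Fin (2 * m)) :
    toResidues h τ ((μ : ℕ) : ZMod (2 * m)) = h μ τ := by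
  unfold toResidues
  congr
  exact ZMod.val_cast_of_lt μ.2

theorem toResidues_of_cast [NeZero m] (H : ℍ → ZMod (2 * m) → ℂ) :
    toResidues (fun μ τ => H τ ((μ : ℕ) : ZMod (2 * m))) = H := by
  funext τ x
  simp [toResidues]

theorem natCast_fin_bijective (n : ℕ) [NeZero n] :
    Function.Bijective fun μ : Fin n => ((μ : ℕ) : ZMod n) := by
  refine (Fintype.bijective_iff_injective_and_card _).mpr ⟨fun a b hab => ?_, by simp⟩
  have := (ZMod.natCast_eq_natCast_iff' _ _ _).mp hab
  rwa [Nat.mod_eq_of_lt a.2, Nat.mod_eq_of_lt b.2, ← Fin.ext_iff] at this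

theorem isThetaExpansion_iff [NeZero m] {φ : ℍ → ℂ → ℂ} {h : Fin (2 * m) → ℍ → ℂ} :
    IsThetaExpansion m φ h ↔ ∀ τ z, φ τ z = thetaSeries m (toResidues h τ) τ z := by
  unfold IsThetaExpansion
  refine forall₂_congr fun τ z => ?_
  rw [thetaSeries_eq_sum_theta, ← (natCast_fin_bijective (2 * m)).sum_comp]
  simp only [toResidues_natCast]
  have (μ : Fin (2 * m)) : (((μ : ℕ) : ZMod (2 * m))).val = μ := ZMod.val_cast_of_lt μ.2
  simp only [this]

/-- Translation `τ ↦ τ + N` acts diagonally on coefficient vectors. -/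
theorem thetaSeries_add_nat [NeZero m] (N : ℕ) {τ τ' : ℍ} (hτ : (τ' : ℂ) = τ + N)
    (H : ZMod (2 * m) → ℂ) (z : ℂ) :
    thetaSeries m H τ' z =
      thetaSeries m (fun x => e ((x.val : ℂ) ^ 2 * N / (4 * m)) * H x) τ z := by
  have hm : (m : ℂ) ≠ 0 := by exact_mod_cast NeZero.ne m
  refine tsum_congr fun r => ?_
  obtain ⟨j, hj⟩ : ∃ j : ℤ, ((-r : ZMod (2 * m)).val : ℤ) = -r + 2 * m * j := by
    have h0 : (((-r : ZMod (2 * m)).val + r : ℤ) : ZMod (2 * m)) = 0 := by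
      push_cast
      simp
    obtain ⟨j, hj⟩ := (ZMod.intCast_zmod_eq_zero_iff_dvd _ _).mp h0
    exact ⟨j, by push_cast at hj; linarith⟩
  have hj' : ((-r : ZMod (2 * m)).val : ℂ) = -r + 2 * m * j := by exact_mod_cast hj
  have h1 : ((-r : ZMod (2 * m)).val : ℂ) ^ 2 * N / (4 * m)
      = (r : ℂ) ^ 2 * N / (4 * m) + ((j * (m * j - r) * N : ℤ) : ℂ) := by
    rw [hj']
    push_cast
    field_simp
    ring
  simp only
  rw [h1, hτ, e_add _ (Int.cast _), e_intCast, mul_one, mul_comm (e _), mul_assoc, ← e_add]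
  ring_nf

/-- The inversion formula for a single theta function, which is Poisson summation in the form of
the functional equation of Jacobi's theta function. -/
theorem theta_neg_inv [NeZero m] (x : ℤ) {τ τ' : ℍ} (hτ : (τ' : ℂ) = -1 / τ) (z : ℂ) :
    theta m x τ' (z / τ) = (-Complex.I * (τ / (2 * m))) ^ (1 / 2 : ℂ) * e (m * z ^ 2 / τ) *
      thetaSeries m (fun y => ZMod.stdAddChar (-((x : ZMod (2 * m)) * y))) τ z := by
  have hm : (m : ℂ) ≠ 0 := by exact_mod_cast NeZero.ne m
  have hτ0 : (τ : ℂ) ≠ 0 := τ.ne_zero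
  have hser : thetaSeries m (fun y => ZMod.stdAddChar (-((x : ZMod (2 * m)) * y))) τ z =
      jacobiTheta₂ (z + x / (2 * m)) (τ / (2 * m)) := by
    refine tsum_congr fun r => ?_
    have : -((x : ZMod (2 * m)) * -(r : ZMod (2 * m))) = ((x * r : ℤ) : ZMod (2 * m)) := by
      push_cast
      ring
    simp only
    rw [this, stdAddChar_intCast, ← e_gauss_eq_jacobiTheta₂_term, ← e_add]
    push_cast
    ring_nf
  have hth : theta m x τ' (z / τ) = e (-(x ^ 2) / (4 * m * τ) - x * z / τ) *
      jacobiTheta₂ ((2 * m * z + x) / τ) (-(2 * m) / τ) := by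
    rw [theta, jacobiTheta₂, ← tsum_mul_left]
    refine tsum_congr fun n => ?_
    rw [jacobiTheta₂_term, hτ, e, e, ← Complex.exp_add]
    congr 1
    field_simp
    ring
  have hpow : (-Complex.I * (τ / (2 * m))) ^ (1 / 2 : ℂ) ≠ 0 := by
    rw [Ne, Complex.cpow_eq_zero_iff]
    simp [hm, hτ0]
  rw [hser, jacobiTheta₂_functional_equation, hth]
  have h1 : (z + x / (2 * m)) / (τ / (2 * m)) = (2 * m * z + x) / τ := by field_simp
  have h2 : -1 / ((τ : ℂ) / (2 * m)) = -(2 * m) / τ := by field_simp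
  have h3 : Complex.exp (-Real.pi * Complex.I * (z + x / (2 * m)) ^ 2 / (τ / (2 * m))) =
      e (-m * (z + x / (2 * m)) ^ 2 / τ) := by
    rw [e]
    congr 1
    field_simp
  have h4 : e (-(x ^ 2) / (4 * m * τ) - x * z / τ) =
      e (m * z ^ 2 / τ) * e (-m * (z + x / (2 * m)) ^ 2 / τ) := by
    rw [← e_add]
    congr 1
    field_simp
    ring
  rw [h1, h2, h3, h4]
  field_simp

/-- The inversion `τ ↦ -1/τ` acts on coefficient vectors by the discrete Fourier transform. -/
theorem thetaSeries_neg_inv [NeZero m] (H : ZMod (2 * m) → ℂ) {τ τ' : ℍ} (hτ : (τ' : ℂ) = -1 / τ)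
    (z : ℂ) :
    thetaSeries m H τ' (z / τ) = (-Complex.I * (τ / (2 * m))) ^ (1 / 2 : ℂ) * e (m * z ^ 2 / τ) *
      thetaSeries m (ZMod.dft H) τ z := by
  rw [thetaSeries_eq_sum_theta]
  simp only [theta_neg_inv _ hτ]
  have (x : ZMod (2 * m)) (A B C : ℂ) : H x * (A * B * C) = A * B * (H x * C) := by ring
  simp only [this]
  rw [← Finset.mul_sum, sum_mul_thetaSeries]
  congr 2
  funext y
  rw [ZMod.dft_apply]
  refine Finset.sum_congr rfl fun x _ => ?_
  simp [mul_comm]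

end ThetaSeries

/-! ### Propagation of zeros to the non-primitive residues -/

theorem sum_range_e_div (d : ℕ) [NeZero d] (j : ℤ) :
    ∑ t ∈ Finset.range d, e (t * (j / d)) = if (d : ℤ) ∣ j then (d : ℂ) else 0 := by
  have hd : (d : ℂ) ≠ 0 := by exact_mod_cast NeZero.ne d
  simp only [e_nat_mul]
  split_ifs with h
  · obtain ⟨i, rfl⟩ := h
    have : ((d * i : ℤ) : ℂ) / d = (i : ℤ) := by
      push_cast
      field_simp
    rw [this, e_intCast]
    simp
  · have h1 : e ((j : ℂ) / d) ≠ 1 := by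
      intro h1
      rw [e, Complex.exp_eq_one_iff] at h1
      obtain ⟨i, hi⟩ := h1
      refine h ⟨i, ?_⟩
      have h2 : (j : ℂ) / d = i := by
        have : 2 * (Real.pi : ℂ) * Complex.I ≠ 0 := by simp [Real.pi_ne_zero]
        apply mul_left_cancel₀ this
        rw [hi]
        ring
      rw [div_eq_iff hd] at h2
      have : j = i * d := by exact_mod_cast h2
      rw [this, mul_comm]
    have h2 := mul_geom_sum (e ((j : ℂ) / d)) d
    rw [← e_nat_mul, mul_div_cancel₀ _ hd, e_intCast, sub_self] at h2
    exact (mul_eq_zero.mp h2).resolve_left (sub_ne_zero.mpr h1)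

/-- If the `y`-th coordinate of all the vectors obtained from `w` by multiplying the Fourier
transform with the powers of `ν ↦ e(ν²N/4m)` vanishes, then so does the sum of `w` over the coset
of `y` modulo the multiples of `2m/d`. Indeed the average of these multipliers over the exponents
divisible by `q' = 4m/q` is the indicator function of `q ∣ ν²N`, that is of `d ∣ ν`, and its Fourier
transform is supported on the multiples of `d' = 2m/d`. -/
theorem sum_coset_eq_zero {m N d q d' q' : ℕ} [NeZero m] (hd : d * d' = 2 * m)
    (hq : q * q' = 4 * m)
    (hdq : ∀ ν : ℤ, (q : ℤ) ∣ ν ^ 2 * N ↔ (d : ℤ) ∣ ν) (w : ZMod (2 * m) → ℂ) (y : ZMod (2 * m))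
    (hw : ∀ c : ℕ, ∑ ν : ZMod (2 * m), ZMod.stdAddChar (ν * y) *
      (e (c * ((ν.val : ℂ) ^ 2 * N / (4 * m))) * ZMod.dft w ν) = 0) :
    ∑ t ∈ Finset.range d, w (y + t * d') = 0 := by
  have hm : (m : ℂ) ≠ 0 := by exact_mod_cast NeZero.ne m
  have hm0 := NeZero.ne m
  have : NeZero d := ⟨by rintro rfl; simp_all⟩
  have : NeZero q := ⟨by rintro rfl; simp_all⟩
  have hd0 : (d : ℂ) ≠ 0 := by exact_mod_cast NeZero.ne d
  have hq0 : (q : ℂ) ≠ 0 := by exact_mod_cast NeZero.ne q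
  have hdC : (d : ℂ) * d' = 2 * m := by exact_mod_cast hd
  have hqC : (q : ℂ) * q' = 4 * m := by exact_mod_cast hq
  have hinv (x : ZMod (2 * m)) : w x = ((2 * m : ℕ) : ℂ)⁻¹ *
      ∑ ν, ZMod.stdAddChar (ν * x) * ZMod.dft w ν := by
    conv_lhs => rw [← ZMod.dft.symm_apply_apply w]
    rw [ZMod.invDFT_apply]
    simp only [smul_eq_mul]
  have hA (ν : ZMod (2 * m)) : ∑ t ∈ Finset.range d, ZMod.stdAddChar (ν * (t * d' : ZMod (2 * m)))
      = if (d : ℤ) ∣ (ν.val : ℤ) then (d : ℂ) else 0 := by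
    rw [← sum_range_e_div]
    refine Finset.sum_congr rfl fun t _ => ?_
    have h1 : ν * (t * d' : ZMod (2 * m)) = ((ν.val * (t * d') : ℤ) : ZMod (2 * m)) := by
      push_cast
      simp
    rw [h1, stdAddChar_intCast]
    congr 1
    push_cast
    rw [← hdC]
    have : (d' : ℂ) ≠ 0 := by rintro h; simp_all
    field_simp
  have hB (ν : ZMod (2 * m)) :
      ∑ c ∈ Finset.range q, e (((c * q' : ℕ) : ℂ) * ((ν.val : ℂ) ^ 2 * N / (4 * m)))
      = if (d : ℤ) ∣ (ν.val : ℤ) then (q : ℂ) else 0 := by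
    have := sum_range_e_div q ((ν.val : ℤ) ^ 2 * N)
    simp only [hdq] at this
    rw [← this]
    refine Finset.sum_congr rfl fun c _ => ?_
    congr 1
    push_cast
    rw [← hqC]
    have : (q' : ℂ) ≠ 0 := by rintro h; simp_all
    field_simp
  have h1 : ∑ c ∈ Finset.range q, ∑ ν : ZMod (2 * m), ZMod.stdAddChar (ν * y) *
      (e (((c * q' : ℕ) : ℂ) * ((ν.val : ℂ) ^ 2 * N / (4 * m))) * ZMod.dft w ν) = 0 :=
    Finset.sum_eq_zero fun c _ => hw _
  have h2 : ∑ t ∈ Finset.range d, w (y + t * d') = ((2 * m : ℕ) : ℂ)⁻¹ *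
      ∑ ν, ZMod.stdAddChar (ν * y) * ((if (d : ℤ) ∣ (ν.val : ℤ) then (d : ℂ) else 0) *
        ZMod.dft w ν) := by
    simp only [hinv, ← Finset.mul_sum, ← hA]
    rw [Finset.sum_comm]
    congr 1
    refine Finset.sum_congr rfl fun ν _ => ?_
    simp only [mul_add, AddChar.map_add_eq_mul, Finset.sum_mul, Finset.mul_sum]
    refine Finset.sum_congr rfl fun t _ => by ring
  rw [Finset.sum_comm] at h1
  simp only [← Finset.mul_sum, ← Finset.sum_mul, hB] at h1
  rw [h2]
  have h3 : ∀ ν : ZMod (2 * m), ZMod.stdAddChar (ν * y) *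
      ((if (d : ℤ) ∣ (ν.val : ℤ) then (d : ℂ) else 0) * ZMod.dft w ν) = (d / q : ℂ) *
      (ZMod.stdAddChar (ν * y) *
        ((if (d : ℤ) ∣ (ν.val : ℤ) then (q : ℂ) else 0) * ZMod.dft w ν)) := by
    intro ν
    split_ifs
    · field_simp
    · simp
  simp only [h3, ← Finset.mul_sum, h1, mul_zero]

/-- For even squarefree `m`, odd `N` and even `x`, the quadratic exponents of `x` and `x + m`
differ by a half-integer. -/
theorem e_quadratic_add_half {m N : ℕ} (hm : Squarefree m) (hme : 2 ∣ m) (hN : Odd N) {x : ℤ}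
    (hx : 2 ∣ x) (j : ℤ) :
    e (((x + m + 2 * m * j : ℤ) : ℂ) ^ 2 * N / (4 * m)) = -e ((x : ℂ) ^ 2 * N / (4 * m)) := by
  obtain ⟨m', rfl⟩ := hme
  obtain ⟨x', rfl⟩ := hx
  have hm0 : (m' : ℂ) ≠ 0 := by
    have := hm.ne_zero
    simp at this
    exact_mod_cast this
  have hodd : Odd m' := by
    rw [← Nat.not_even_iff_odd]
    rintro h
    obtain ⟨i, rfl⟩ := h.two_dvd
    have := hm 2 ⟨i, by ring⟩
    simp at this
  obtain ⟨a, rfl⟩ := hodd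
  obtain ⟨b, rfl⟩ := hN
  have hhalf : e (1 / 2) = -1 := by
    rw [e, ← Complex.exp_pi_mul_I]
    ring_nf
  have : (((2 * x' + (2 * (2 * a + 1) : ℕ) + 2 * (2 * (2 * a + 1) : ℕ) * j : ℤ) : ℂ) ^ 2 *
      (2 * b + 1 : ℕ) / (4 * (2 * (2 * a + 1) : ℕ)) : ℂ) =
      ((2 * x' : ℤ) : ℂ) ^ 2 * (2 * b + 1 : ℕ) / (4 * (2 * (2 * a + 1) : ℕ)) +
      (((x' * (1 + 2 * j) + (2 * a + 1) * 2 * (j + j ^ 2)) * (2 * b + 1) + 2 * a * b + a + b : ℤ)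
        : ℂ) + 1 / 2 := by
    push_cast at hm0 ⊢
    field_simp
    ring
  rw [this, e_add, e_add, e_intCast, hhalf]
  ring

/-- The family `h` of vectors is stable under division by `x ↦ e(x²N/4m)` and, up to scalars, under
the powers of the Fourier conjugate of multiplication by this function. If the coordinates at the units vanish, then all coordinates do. -/
theorem eq_zero_of_coprime_eq_zero {m N : ℕ} [NeZero m] (hN : Odd N) (hm : Squarefree m)
    (hNm : Nat.Coprime N m) {X : Type*} (h : X → ZMod (2 * m) → ℂ)
    (hT : ∀ τ, ∃ τ', ∀ x, e ((x.val : ℂ) ^ 2 * N / (4 * m)) * h τ' x = h τ x)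
    (hS : ∀ (τ : X) (c : ℕ), ∃ τ', ∃ C : ℂ, C ≠ 0 ∧ ∀ ν,
      ZMod.dft (h τ') ν = C * (e (c * ((ν.val : ℂ) ^ 2 * N / (4 * m))) * ZMod.dft (h τ) ν))
    (h0 : ∀ x : ℤ, IsCoprime x (2 * m : ℕ) → ∀ τ, h τ x = 0) (τ : X) (x : ZMod (2 * m)) :
    h τ x = 0 := by
  have hcoset {d q d' q' : ℕ} (hd : d * d' = 2 * m) (hq : q * q' = 4 * m)
      (hdq : ∀ ν : ℤ, (q : ℤ) ∣ ν ^ 2 * N ↔ (d : ℤ) ∣ ν) (y : ZMod (2 * m))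
      (hy : ∀ τ, h τ y = 0) (τ : X) : ∑ t ∈ Finset.range d, h τ (y + t * d') = 0 := by
    refine sum_coset_eq_zero hd hq hdq (h τ) y fun c => ?_
    obtain ⟨τ', C, hC, hν⟩ := hS τ c
    have h1 := hy τ'
    rw [← ZMod.dft.symm_apply_apply (h τ'), ZMod.invDFT_apply] at h1
    simp only [hν, smul_eq_mul, mul_left_comm _ C, ← Finset.mul_sum] at h1
    simpa [NeZero.ne m, hC] using h1
  obtain ⟨x, rfl⟩ := ZMod.intCast_surjective x
  revert τ
  induction hn : ((2 * m).primeFactors.filter fun p : ℕ => (p : ℤ) ∣ x).card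
    using Nat.strong_induction_on generalizing x with
  | _ n ih =>
  by_cases hx : IsCoprime x (2 * m : ℕ)
  · exact h0 x hx
  obtain ⟨p, hp, hpm, hpx⟩ : ∃ p : ℕ, p.Prime ∧ p ∣ 2 * m ∧ (p : ℤ) ∣ x := by
    rw [Int.isCoprime_iff_gcd_eq_one, Int.gcd] at hx
    obtain ⟨p, hp, h1, h2⟩ := Nat.Prime.not_coprime_iff_dvd.mp hx
    exact ⟨p, hp, by rwa [Int.natAbs_natCast] at h2, Int.natCast_dvd.mpr h1⟩
  -- Moving `x` by a step prime to `p` in its coset removes `p` from the common prime factors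
  -- with `2m` and adds none.
  have hstep {i d' : ℕ} (hd : p ^ i * d' = 2 * m) (hpd' : ¬ p ∣ d') (t : ℤ) (ht : ¬ (p : ℤ) ∣ t) :
      ∀ τ, h τ ((x + t * d' : ℤ) : ZMod (2 * m)) = 0 := by
    refine ih _ ?_ _ rfl
    have hpp : Prime (p : ℤ) := Nat.prime_iff_prime_int.mp hp
    have hpnot : ¬ (p : ℤ) ∣ x + t * d' := by
      rw [dvd_add_right hpx, hpp.dvd_mul]
      rintro (h | h)
      · exact ht h
      · exact hpd' (by exact_mod_cast h)
    rw [← hn]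
    refine Finset.card_lt_card (Finset.ssubset_iff_subset_ne.mpr ⟨fun l hl => ?_, fun heq => ?_⟩)
    · simp only [Finset.mem_filter, Nat.mem_primeFactors] at hl ⊢
      obtain ⟨⟨hl1, hl2, hl3⟩, hl4⟩ := hl
      refine ⟨⟨hl1, hl2, hl3⟩, ?_⟩
      have hld : l ∣ d' := by
        rw [← hd, hl1.dvd_mul] at hl2
        refine hl2.resolve_left fun hlp => ?_
        have := (Nat.prime_dvd_prime_iff_eq hl1 hp).mp (hl1.dvd_of_dvd_pow hlp)
        exact hpnot (this ▸ hl4)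
      have : (l : ℤ) ∣ t * d' := Dvd.dvd.mul_left (by exact_mod_cast hld) _
      exact (dvd_add_left this).mp hl4
    · have : p ∈ (2 * m).primeFactors.filter fun p : ℕ => (p : ℤ) ∣ x := by
        simp [hp, hpm, hpx, NeZero.ne m]
      rw [← heq] at this
      exact hpnot (Finset.mem_filter.mp this).2
  -- When `p` divides `2m` exactly once, the coset of `x` has only one element divisible by `p`.
  have honce {d' q q' : ℕ} (hd : p * d' = 2 * m) (hpd' : ¬ p ∣ d') (hq : q * q' = 4 * m)
      (hdq : ∀ ν : ℤ, (q : ℤ) ∣ ν ^ 2 * N ↔ (p : ℤ) ∣ ν) (τ : X) :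
      h τ (x : ZMod (2 * m)) = 0 := by
    have hst := hstep (i := 1) (by simpa using hd) hpd'
    have h1 := hcoset hd hq hdq ((x + 1 * d' : ℤ) : ZMod (2 * m))
      (hst 1 fun h => by
        have := Int.le_of_dvd one_pos h
        have := hp.two_le
        omega) τ
    obtain ⟨p', rfl⟩ : ∃ p', p = p' + 1 := ⟨p - 1, by have := hp.pos; omega⟩
    rw [Finset.sum_range_succ, Finset.sum_eq_zero, zero_add] at h1
    · rw [← h1]
      congr 1
      have h2 : ((p' : ZMod (2 * m)) + 1) * d' = 0 := by
        exact_mod_cast (congrArg (Nat.cast : ℕ → ZMod (2 * m)) hd).trans (ZMod.natCast_self _)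
      push_cast
      linear_combination -h2
    · intro t ht
      rw [Finset.mem_range] at ht
      have h3 := hst (t + 1) (fun h => by
        have := Int.le_of_dvd (by positivity) h
        push_cast at this
        omega) τ
      rw [← h3]
      congr 1
      push_cast
      ring
  have hdvd {a b : ℤ} (ha : IsCoprime a N) : a ∣ b * N ↔ a ∣ b :=
    ⟨ha.dvd_of_dvd_mul_right, fun h => h.mul_right _⟩
  by_cases hp2 : p = 2
  · subst hp2
    have hNodd : IsCoprime (2 : ℤ) (N : ℤ) := by
      exact_mod_cast Nat.isCoprime_iff_coprime.mpr (Nat.coprime_two_left.mpr hN)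
    by_cases hme : 2 ∣ m
    · obtain ⟨m', rfl⟩ := hme
      have hm' : ¬ 2 ∣ m' := by
        rintro ⟨i, rfl⟩
        have := hm 2 ⟨i, by ring⟩
        simp at this
      have hst := hstep (i := 2) (d' := m') (by ring) hm'
      -- Now two elements of the coset are even, and `e(x²N/4m)` tells them apart by a sign.
      have hsum : ∀ τ, h τ (x : ZMod (2 * (2 * m'))) +
          h τ ((x + (2 * m' : ℕ) : ℤ) : ZMod (2 * (2 * m'))) = 0 := by
        intro τ
        have h1 := hcoset (d := 4) (q := 8) (d' := m') (q' := m') (by ring) (by ring)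
          (fun ν => by
            have hco : IsCoprime (8 : ℤ) N := by
              have := hNodd.pow_left (m := 3)
              norm_num at this
              exact this
            push_cast
            rw [hdvd hco]
            have hdec : ∀ v : ZMod 8, v ^ 2 = 0 ↔ 2 * v = 0 := by decide
            have := hdec (ν : ZMod 8)
            norm_cast at this
            rw [ZMod.intCast_zmod_eq_zero_iff_dvd, ZMod.intCast_zmod_eq_zero_iff_dvd] at this
            push_cast at this
            rw [this]
            omega) _ (hst 1 (by decide)) τ
        have e1 := hst 3 (by decide) τ
        have e0 := hst 1 (by decide) τ
        have hz : (4 : ZMod (2 * (2 * m'))) * m' = 0 := by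
          have := ZMod.natCast_self (2 * (2 * m'))
          push_cast at this
          linear_combination this
        push_cast at h1 e0 e1 ⊢
        simp only [Finset.sum_range_succ, Finset.sum_range_zero] at h1
        push_cast at h1
        have a0 : (x + 1 * m' + 0 * m' : ZMod (2 * (2 * m'))) = x + 1 * m' := by ring
        have a1 : (x + 1 * m' + 1 * m' : ZMod (2 * (2 * m'))) = x + 2 * m' := by ring
        have a2 : (x + 1 * m' + 2 * m' : ZMod (2 * (2 * m'))) = x + 3 * m' := by ring
        have a3 : (x + 1 * m' + 3 * m' : ZMod (2 * (2 * m'))) = x := by linear_combination hz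
        rw [a0, a1, a2, a3, e0, e1] at h1
        linear_combination h1
      intro τ
      obtain ⟨τ', hτ'⟩ := hT τ
      have hval (j : ℤ) : ∃ i : ℤ, (((j : ZMod (2 * (2 * m'))).val : ℤ)) =
          j + 2 * (2 * m' : ℕ) * i := by
        rw [ZMod.val_intCast]
        refine ⟨-(j / (2 * (2 * m') : ℕ)), ?_⟩
        rw [Int.emod_def]
        push_cast
        ring
      obtain ⟨i, hi⟩ := hval x
      obtain ⟨j, hj⟩ := hval (x + (2 * m' : ℕ))
      have hi2 : (2 : ℤ) ∣ (x : ZMod (2 * (2 * m'))).val := by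
        rw [hi]
        exact dvd_add hpx ⟨(2 * m' : ℕ) * i, by ring⟩
      have h1 := hτ' (x : ZMod (2 * (2 * m')))
      have h2 := hτ' ((x + (2 * m' : ℕ) : ℤ) : ZMod (2 * (2 * m')))
      have h3 := e_quadratic_add_half hm ⟨m', rfl⟩ hN hi2 (j - i)
      have h4 : ((x : ZMod (2 * (2 * m'))).val + (2 * m' : ℕ) + 2 * (2 * m' : ℕ) * (j - i) : ℤ) =
          ((x + (2 * m' : ℕ) : ℤ) : ZMod (2 * (2 * m'))).val := by
        rw [hi, hj]
        ring
      rw [h4] at h3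
      simp only [Int.cast_natCast] at h3
      rw [h3] at h2
      have h5 := hsum τ
      have h6 := hsum τ'
      have h7 : 2 * h τ (x : ZMod (2 * (2 * m'))) = 0 := by
        linear_combination h5 + h2 - h1 +
          e ((x : ZMod (2 * (2 * m'))).val ^ 2 * N / (4 * (2 * m' : ℕ))) * h6
      simpa using h7
    · exact honce (q := 4) (q' := m) rfl hme rfl fun ν => by
        have hco : IsCoprime (4 : ℤ) N := by
          have := hNodd.pow_left (m := 2)
          norm_num at this
          exact this
        push_cast
        rw [hdvd hco]
        have hdec : ∀ v : ZMod 4, v ^ 2 = 0 ↔ 2 * v = 0 := by decide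
        have := hdec (ν : ZMod 4)
        norm_cast at this
        rw [ZMod.intCast_zmod_eq_zero_iff_dvd, ZMod.intCast_zmod_eq_zero_iff_dvd] at this
        push_cast at this
        rw [this]
        omega
  · have hpm' : p ∣ m := ((Nat.coprime_primes hp Nat.prime_two).mpr hp2).dvd_of_dvd_mul_left hpm
    obtain ⟨d', hd'⟩ := hpm'
    have hpd' : ¬ p ∣ 2 * d' := by
      intro hdvd
      obtain ⟨i, rfl⟩ := ((Nat.coprime_primes hp Nat.prime_two).mpr hp2).dvd_of_dvd_mul_left hdvd
      have := hm p ⟨i, by rw [hd']; ring⟩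
      exact hp.one_lt.ne' (Nat.isUnit_iff.mp this)
    have hpN : IsCoprime (p : ℤ) (N : ℤ) := by
      rw [Nat.isCoprime_iff_coprime]
      exact (Nat.Coprime.coprime_dvd_right ⟨d', hd'⟩ hNm).symm
    refine honce (d' := 2 * d') (q := p) (q' := 4 * d') (by rw [hd']; ring) hpd'
      (by rw [hd']; ring) fun ν => ?_
    rw [hdvd hpN]
    exact (Nat.prime_iff_prime_int.mp hp).dvd_pow_iff_dvd two_ne_zero

/-! ### Fourier expansions of Jacobi forms -/

/-- A Fourier series with the quasi-period `τ` of index `m` is a theta series. -/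
theorem exists_eq_thetaSeries {m : ℕ} [NeZero m] {τ : ℍ} {f : ℂ → ℂ} {a : ℤ → ℂ}
    (ha : ∀ z, HasSum (fun r : ℤ => a r * e (r * z)) (f z))
    (hf : ∀ z, f (z + τ) * e (m * (τ + 2 * z)) = f z) :
    ∃ H : ZMod (2 * m) → ℂ, ∀ z, f z = thetaSeries m H τ z := by
  have hm : (m : ℂ) ≠ 0 := by exact_mod_cast NeZero.ne m
  -- The translation law says that `f` is also the Fourier series with the coefficients
  -- `a (r - 2m) e((r - m)τ)`.
  have hrec (r : ℤ) : a r - a (r - 2 * m) * e ((r - m) * τ) = 0 := by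
    refine fourier_coeff_eq_zero (a := fun r => a r - a (r - 2 * m) * e ((r - m) * τ))
      (fun x => ?_) r
    have h1 := (ha (x + τ)).mul_right (e (m * (τ + 2 * x)))
    rw [hf, ← (Equiv.subRight (2 * m : ℤ)).hasSum_iff] at h1
    have h2 := (ha x).sub h1
    rw [sub_self] at h2
    refine h2.congr_fun fun r => ?_
    simp only [Function.comp, Equiv.subRight_apply]
    rw [sub_mul, mul_assoc, mul_assoc, ← e_add, ← e_add]
    push_cast
    ring_nf
  have hper : Function.Periodic (fun r : ℤ => a r * e (-((r : ℂ) ^ 2 / (4 * m) * τ))) (2 * m) := by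
    intro r
    have h1 := hrec (r + 2 * m)
    rw [add_sub_cancel_right, sub_eq_zero] at h1
    simp only
    rw [h1, mul_assoc, ← e_add]
    congr 2
    push_cast
    field_simp
    ring
  refine ⟨fun x => a (-x.val) * e (-(((-x.val : ℤ) : ℂ) ^ 2 / (4 * m) * τ)), fun z => ?_⟩
  refine (ha z).unique ((hasSum_thetaSeries _ τ z).congr_fun fun r => ?_)
  obtain ⟨j, hj⟩ : ∃ j : ℤ, -((-r : ZMod (2 * m)).val : ℤ) = r - j * (2 * m) := by
    have h0 : (((-r : ZMod (2 * m)).val + r : ℤ) : ZMod (2 * m)) = 0 := by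
      push_cast
      simp
    obtain ⟨j, hj⟩ := (ZMod.intCast_zmod_eq_zero_iff_dvd _ _).mp h0
    exact ⟨j, by push_cast at hj; linarith⟩
  have h1 := hper.sub_int_mul_eq (x := r) j
  simp only [hj]
  simp only [Int.cast_id] at h1
  rw [h1, mul_assoc, ← e_add]
  ring_nf

theorem slash_one (k : ℤ) (m : ℕ) (φ : ℍ → ℂ → ℂ) : slash k m 1 φ = φ := by
  funext τ z
  simp [slash, e_zero]

theorem slash_S (k : ℤ) (m : ℕ) (φ : ℍ → ℂ → ℂ) (τ : ℍ) (z : ℂ) :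
    slash k m ModularGroup.S φ τ z =
      φ (ModularGroup.S • τ) (z / τ) * (τ : ℂ) ^ (-k) * e (-(m * z ^ 2 / τ)) := by
  simp [slash, ModularGroup.S, mul_div_assoc, neg_div]

theorem coe_S_smul (τ : ℍ) : ((ModularGroup.S • τ : ℍ) : ℂ) = -1 / τ := by
  rw [modular_S_smul]
  simp [neg_div, ← inv_neg]

theorem S_smul_S_smul (τ : ℍ) : ModularGroup.S • ModularGroup.S • τ = τ := by
  ext
  rw [coe_S_smul, coe_S_smul]
  simp [neg_div]

/-- A Fourier expansion in powers of `e(τ/N)` is invariant under translation by multiples of `N`. -/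
theorem HasBoundedFourierExpansion.translate {m N : ℕ} {ψ : ℍ → ℂ → ℂ} (hN : N ≠ 0)
    (h : HasBoundedFourierExpansion m N ψ) (c : ℕ) {τ τ' : ℍ} (hτ : (τ' : ℂ) = τ + (c * N : ℕ))
    (z : ℂ) : ψ τ' z = ψ τ z := by
  obtain ⟨a, -, ha⟩ := h
  have hN' : (N : ℂ) ≠ 0 := by exact_mod_cast hN
  refine (ha τ' z).unique ((ha τ z).congr_fun fun p => ?_)
  have : (p.1 : ℂ) / N * τ' = (p.1 : ℂ) / N * τ + ((p.1 * c : ℤ) : ℂ) := by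
    rw [hτ]
    push_cast
    field_simp
  rw [this, e_add, e_intCast, mul_one]

theorem HasBoundedFourierExpansion.exists_hasSum {m N : ℕ} {ψ : ℍ → ℂ → ℂ}
    (h : HasBoundedFourierExpansion m N ψ) (τ : ℍ) :
    ∃ a : ℤ → ℂ, ∀ z, HasSum (fun r : ℤ => a r * e (r * z)) (ψ τ z) := by
  obtain ⟨c, -, hc⟩ := h
  have hc' (z : ℂ) := (Equiv.prodComm ℤ ℤ).hasSum_iff.mpr (hc τ z)
  refine ⟨fun r => ∑' n : ℤ, c (n, r) * e ((n : ℂ) / N * τ), fun z => ?_⟩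
  refine (hc' z).prod_fiberwise fun r => ?_
  have := ((hc' 0).summable.prod_factor r).hasSum.mul_right (e (r * z))
  simpa [e_zero, Function.comp_def] using this

end Jacobi

end

/-! ### Primitive theta components -/

open UpperHalfPlane Jacobi in
theorem corollary3p4 (k : ℤ) (m N : ℕ) (hN : Odd N) (hm : Squarefree m) (hNm : Nat.Coprime N m)
    (φ : UpperHalfPlane → ℂ → ℂ) (hφ : φ ∈ Jacobi.J k m N) (hφ0 : φ ≠ 0) :
    (∃! h : Fin (2 * m) → UpperHalfPlane → ℂ, Jacobi.IsThetaExpansion m φ h) ∧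
      ∀ h : Fin (2 * m) → UpperHalfPlane → ℂ, Jacobi.IsThetaExpansion m φ h →
        ∃ μ : Fin (2 * m), Nat.Coprime (μ : ℕ) (2 * m) ∧ h μ ≠ 0 := by
  have : NeZero m := ⟨hm.ne_zero⟩
  have hN0 : N ≠ 0 := by rintro rfl; simp at hN
  have hφ : IsJacobiForm k m N φ := hφ
  have hF1 := hφ.bounded_at_cusps 1
  rw [slash_one] at hF1
  have hFS := hφ.bounded_at_cusps ModularGroup.S
  refine ⟨?_, fun h hh => ?_⟩
  · have hex (τ : ℍ) : ∃ H : ZMod (2 * m) → ℂ, ∀ z, φ τ z = thetaSeries m H τ z := by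
      obtain ⟨a, ha⟩ := hF1.exists_hasSum τ
      exact exists_eq_thetaSeries ha fun z => by simpa using hφ.translate_eq 1 0 τ z
    choose H hH using hex
    refine ⟨fun μ τ => H τ ((μ : ℕ) : ZMod (2 * m)), ?_, fun h hh => ?_⟩
    · refine isThetaExpansion_iff.mpr fun τ z => ?_
      rw [toResidues_of_cast, hH]
    · replace hh := isThetaExpansion_iff.mp hh
      funext μ τ
      rw [← toResidues_natCast h, thetaSeries_injective fun z => (hh τ z).symm.trans (hH τ z)]
  · by_contra! hzero
    rw [isThetaExpansion_iff] at hh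
    refine hφ0 ?_
    -- The components of `φ|S` are, up to a scalar, the discrete Fourier transforms of those of `φ`.
    have hψ (τ : ℍ) (z : ℂ) : slash k m ModularGroup.S φ τ z =
        ((-Complex.I * (τ / (2 * m))) ^ (1 / 2 : ℂ) * (τ : ℂ) ^ (-k)) *
          thetaSeries m (ZMod.dft (toResidues h (ModularGroup.S • τ))) τ z := by
      rw [slash_S, hh, thetaSeries_neg_inv _ (coe_S_smul τ), e, e]
      have : Complex.exp (2 * Real.pi * Complex.I * -(m * z ^ 2 / τ)) =
          (Complex.exp (2 * Real.pi * Complex.I * (m * z ^ 2 / τ)))⁻¹ := by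
        rw [← Complex.exp_neg]
        ring_nf
      rw [this]
      field_simp
    have hψ0 (τ : ℍ) : (-Complex.I * (τ / (2 * m))) ^ (1 / 2 : ℂ) * (τ : ℂ) ^ (-k) ≠ 0 := by
      refine mul_ne_zero ?_ (zpow_ne_zero _ τ.ne_zero)
      rw [Ne, Complex.cpow_eq_zero_iff]
      simp [NeZero.ne m, τ.ne_zero]
    have hall : ∀ τ x, toResidues h τ x = 0 := by
      refine eq_zero_of_coprime_eq_zero hN hm hNm (toResidues h) (fun τ => ?_) (fun τ c => ?_)
        fun x hx τ => ?_
      · have hτ : (((N : ℝ) +ᵥ τ : ℍ) : ℂ) = τ + N := by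
          rw [coe_vadd, add_comm]
          simp
        refine ⟨(N : ℝ) +ᵥ τ, funext_iff.mp (thetaSeries_injective (τ := τ) fun z => ?_)⟩
        rw [← thetaSeries_add_nat N hτ, ← hh, ← hh]
        exact hF1.translate hN0 1 (by simpa using hτ) z
      · -- Writing `τ = -1/σ`, the vector sought is the value of `h` at `-1/(σ - cN)`.
        obtain ⟨σ, rfl⟩ : ∃ σ, τ = ModularGroup.S • σ := ⟨_, (S_smul_S_smul τ).symm⟩
        obtain ⟨σ', hσ'⟩ : ∃ σ' : ℍ, (σ : ℂ) = σ' + (c * N : ℕ) :=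
          ⟨(-(c * N : ℕ) : ℝ) +ᵥ σ, by rw [coe_vadd]; simp⟩
        refine ⟨ModularGroup.S • σ', _, div_ne_zero (hψ0 σ) (hψ0 σ'),
          funext_iff.mp (thetaSeries_injective (τ := σ') fun z => ?_)⟩
        have h1 := hFS.translate hN0 c hσ' z
        rw [hψ, hψ, thetaSeries_add_nat _ hσ'] at h1
        rw [← mul_thetaSeries, div_mul_eq_mul_div, eq_div_iff (hψ0 σ'), mul_comm, ← h1]
        congr 2
        funext x
        congr 2
        push_cast
        ring
      · have hμ := hzero ⟨_, ZMod.val_lt (x : ZMod (2 * m))⟩ <| by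
          rw [← ZMod.isUnit_iff_coprime, ZMod.natCast_val, ZMod.cast_id]
          exact (ZMod.coe_int_isUnit_iff_isCoprime _ _).mpr hx.symm
        exact congrFun hμ τ
    funext τ z
    rw [hh]
    simp [thetaSeries, hall]
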